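/- Let $R$ be a commutative noetherian ring, let $M$ be a finitely generated $R$-module, and let $n\ge 0$ be an integer. For a finitely generated $R$-module $X$, choose an exact sequence $P_1\xrightarrow{\partial}P_0\to X\to 0$ with $P_0,P_1$ finitely generated projective $R$-modules. The syzygy of $X$ is $\Omega X=\operatorname{Im}\partial$ and the (Auslander) transpose of $X$ is $\operatorname{Tr}X=\operatorname{Coker}\bigl(\operatorname{Hom}_R(\partial,R)\colon \operatorname{Hom}_R(P_0,R)\to\operatorname{Hom}_R(P_1,R)\bigr)$; both are determined by $X$ up to projective direct summands. Put $\Omega^0M=M$ and $\Omega^{j}M=\Omega(\Omega^{j-1}M)$ for $j\ge 1$. For an integer $m\ge0$, the module $X$ is called $m$-torsionfree if $\operatorname{Ext}^j_R(\operatorname{Tr}X,R)=0$ for all integers $1\le j\le m$ (this does not depend on the choice of the presentation). The grade of $X$ is $\operatorname{grade}_RX=\inf\{j\ge0 : \operatorname{Ext}^j_R(X,R)\neq0\}$, with $\inf\emptyset=\infty$. If $\Omega^nM$ is $(n+1)$-torsionfree, then $\operatorname{grade}_R\operatorname{Ext}^i_R(M,R)\ge i$ for all integers $1\le i\le n$.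 -/

import Mathlib

open CategoryTheory CategoryTheory.Abelian

universe u

namespace AuslanderBridger

variable {R : Type u} [CommRing R]

/-- A projective presentation `P₁ --∂--> P₀ --π--> M --> 0` of the `R`-module `M`, exact at `P₀`
and at `M`, with `P₁` and `P₀` finitely generated projective modules. -/
structure ProjPresentation (M : ModuleCat.{u} R) where
  /-- the module in degree one -/
  P₁ : ModuleCat.{u} R
  /-- the module in degree zero -/
  P₀ : ModuleCat.{u} R
  finite_P₁ : Module.Finite R P₁
  finite_P₀ : Module.Finite R P₀
  projective_P₁ : Module.Projective R P₁
  projective_P₀ : Module.Projective R P₀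
  /-- the differential `P₁ → P₀` -/
  d : P₁ →ₗ[R] P₀
  /-- the augmentation `P₀ → M` -/
  π : P₀ →ₗ[R] M
  exact : Function.Exact d π
  surjective : Function.Surjective π

/-- The (first) syzygy `Ω M = Im ∂` computed from a projective presentation of `M`. -/
def ProjPresentation.syzygy {M : ModuleCat.{u} R} (P : ProjPresentation M) : ModuleCat.{u} R :=
  ModuleCat.of R (LinearMap.range P.d)

/-- The Auslander transpose `Tr M = Coker (∂^* : P₀^* → P₁^*)` computed from a projective
presentation of `M`, where `(-)^* = Hom_R(-, R)`. -/
def ProjPresentation.transpose {M : ModuleCat.{u} R} (P : ProjPresentation M) :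
    ModuleCat.{u} R :=
  ModuleCat.of R (Module.Dual R P.P₁ ⧸ LinearMap.range P.d.dualMap)

/-- `IsSyzygy M n N`: the module `N` is (up to isomorphism) an `n`th syzygy `Ω^n M` of `M`, where
`Ω^0 M = M` and `Ω^(n+1) M = Ω (Ω^n M)`, each `Ω` being computed from some projective
presentation. Such an `N` is determined by `M` and `n` up to projective summands. -/
inductive IsSyzygy (M : ModuleCat.{u} R) : ℕ → ModuleCat.{u} R → Prop
  | zero (N : ModuleCat.{u} R) (e : N ≃ₗ[R] M) : IsSyzygy M 0 N
  | succ (n : ℕ) (K N : ModuleCat.{u} R) (hK : IsSyzygy M n K) (P : ProjPresentation K)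
      (e : N ≃ₗ[R] P.syzygy) : IsSyzygy M (n + 1) N

/-- `M` is `n`-torsionfree: `Ext^i_R(Tr M, R) = 0` for all `1 ≤ i ≤ n`. As `Tr M` is determined
up to projective summands, the condition does not depend on the presentation from which `Tr M` is
computed; one presentation for which it holds is asked for. -/
def IsTorsionfree (n : ℕ) (M : ModuleCat.{u} R) : Prop :=
  ∃ P : ProjPresentation M, ∀ i : ℕ, 1 ≤ i → i ≤ n →
    Subsingleton (Ext P.transpose (ModuleCat.of R R) i)

/-- The grade of `M`: the infimum (in `ℕ∞`, so that `grade 0 = ∞`) of the integers `i` with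
`Ext^i_R(M, R) ≠ 0`. -/
noncomputable def grade (M : ModuleCat.{u} R) : ℕ∞ :=
  ⨅ (i : ℕ) (_ : Nontrivial (Ext M (ModuleCat.of R R) i)), (i : ℕ∞)

end AuslanderBridger

namespace AuslanderBridger

/-! The plan is to replace `M` by a module `W` of finite projective dimension without changing
`Ext^i(-, R)` for `1 ≤ i ≤ n`. Torsionfreeness of `N = Ω^n M` yields `0 → N → Q₁ → ⋯ → Q_{n+1}` with
exact dual (`ProjPresentation.hasDualExactCoresolution`). Its first map embeds `N` in a projective
module, with cokernel `V` such that `Ext^1(V, R) = 0`. Each pushout in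
`HasFinitePdEmbedding.of_syzygy` climbs one syzygy and uses one `Q_i`. After `n` of them, `0 → M → W
→ V → 0` has `pd W ≤ n` and `Ext^j(V, R) = 0` for `1 ≤ j ≤ n + 1`, whence `Ext^i(M, R) ≅ Ext^i(W,
R)`.

For such `W`, suppose `Ext^j(E, R) ≠ 0` with `E = Ext^i(W, R)` and `j < i`. Then
`exists_isDepthWitness` gives a prime `p` containing the annihilator of `E` at which `R` has depth
`d ≤ j`. By Auslander–Buchsbaum `W` has projective dimension at most `d < i` at `p`, so an element
outside `p` kills `E`, a contradiction. Localization is avoided: "at `p`" means "up to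
multiplication by an element outside `p`". -/

lemma exists_factor_of_surjective {R A B C : Type*} [Ring R] [AddCommGroup A] [AddCommGroup B]
    [AddCommGroup C] [Module R A] [Module R B] [Module R C] {q : A →ₗ[R] B}
    (hq : Function.Surjective q) (h : A →ₗ[R] C) (hqh : ∀ a, q a = 0 → h a = 0) :
    ∃ σ : B →ₗ[R] C, ∀ a, σ (q a) = h a := by
  refine ⟨(LinearMap.ker q).liftQ h hqh ∘ₗ (q.quotKerEquivOfSurjective hq).symm.toLinearMap,
    fun a ↦ ?_⟩
  have : (q.quotKerEquivOfSurjective hq).symm (q a) = Submodule.Quotient.mk a := by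
    rw [LinearEquiv.symm_apply_eq]; rfl
  rw [LinearMap.comp_apply, LinearEquiv.coe_coe, this]
  exact Submodule.liftQ_apply _ _ _

/-! ### Long exact sequences and functoriality of Ext -/

section ExtSequences

variable {R : Type u} [CommRing R]
variable {A B C : Type u} [AddCommGroup A] [AddCommGroup B] [AddCommGroup C]
  [Module R A] [Module R B] [Module R C]

/-- The map `Ext^n(B, Y) → Ext^n(A, Y)` induced by `f : A → B`. -/
noncomputable abbrev extPrecomp (f : A →ₗ[R] B) (Y : ModuleCat.{u} R) (n : ℕ) :
    Ext (ModuleCat.of R B) Y n →ₗ[R] Ext (ModuleCat.of R A) Y n :=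
  (Ext.mk₀ (ModuleCat.ofHom f)).precompOfLinear R Y (zero_add n)

/-- The map `Ext^n(X, A) → Ext^n(X, B)` induced by `f : A → B`. -/
noncomputable abbrev extPostcomp (f : A →ₗ[R] B) (X : ModuleCat.{u} R) (n : ℕ) :
    Ext X (ModuleCat.of R A) n →ₗ[R] Ext X (ModuleCat.of R B) n :=
  (Ext.mk₀ (ModuleCat.ofHom f)).postcompOfLinear R X (add_zero n)

lemma shortExact_of {f : A →ₗ[R] B} {g : B →ₗ[R] C} (hf : Function.Injective f)
    (hfg : Function.Exact f g) (hg : Function.Surjective g) :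
    (ModuleCat.shortComplexOfCompEqZero f g hfg.linearMap_comp_eq_zero).ShortExact :=
  ModuleCat.shortComplex_shortExact _ hfg hf hg

lemma subsingleton_ext_middle {f : A →ₗ[R] B} {g : B →ₗ[R] C} (hf : Function.Injective f)
    (hfg : Function.Exact f g) (hg : Function.Surjective g) {Y : ModuleCat.{u} R} {n : ℕ}
    (hA : Subsingleton (Ext (ModuleCat.of R A) Y n))
    (hC : Subsingleton (Ext (ModuleCat.of R C) Y n)) :
    Subsingleton (Ext (ModuleCat.of R B) Y n) := by
  refine subsingleton_of_forall_eq 0 fun x ↦ ?_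
  obtain ⟨y, rfl⟩ := Ext.contravariant_sequence_exact₂ (shortExact_of hf hfg hg) Y x
    (Subsingleton.elim _ _)
  rw [show y = 0 from Subsingleton.elim _ _, Ext.comp_zero]

lemma extPrecomp_injective {f : A →ₗ[R] B} {g : B →ₗ[R] C} (hf : Function.Injective f)
    (hfg : Function.Exact f g) (hg : Function.Surjective g) {Y : ModuleCat.{u} R} {n : ℕ}
    (hC : Subsingleton (Ext (ModuleCat.of R C) Y n)) :
    Function.Injective (extPrecomp f Y n) := by
  rw [injective_iff_map_eq_zero]
  intro x hx
  obtain ⟨y, rfl⟩ := Ext.contravariant_sequence_exact₂ (shortExact_of hf hfg hg) Y x hx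
  rw [show y = 0 from Subsingleton.elim _ _, Ext.comp_zero]

lemma extPrecomp_surjective {f : A →ₗ[R] B} {g : B →ₗ[R] C} (hf : Function.Injective f)
    (hfg : Function.Exact f g) (hg : Function.Surjective g) {Y : ModuleCat.{u} R} {n : ℕ}
    (hC : Subsingleton (Ext (ModuleCat.of R C) Y (n + 1))) :
    Function.Surjective (extPrecomp f Y n) := fun x ↦
  Ext.contravariant_sequence_exact₁ (shortExact_of hf hfg hg) Y x (add_comm 1 n)
    (Subsingleton.elim _ _)

lemma exists_extension_of_subsingleton_ext {f : A →ₗ[R] B} {g : B →ₗ[R] C}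
    (hf : Function.Injective f) (hfg : Function.Exact f g) (hg : Function.Surjective g)
    {Y : Type u} [AddCommGroup Y] [Module R Y]
    (hC : Subsingleton (Ext (ModuleCat.of R C) (ModuleCat.of R Y) 1)) (φ : A →ₗ[R] Y) :
    ∃ ψ : B →ₗ[R] Y, ψ ∘ₗ f = φ := by
  obtain ⟨x, hx⟩ := extPrecomp_surjective hf hfg hg hC (Ext.mk₀ (ModuleCat.ofHom φ))
  obtain ⟨ψ, rfl⟩ := (Ext.mk₀_bijective _ _).2 x
  refine ⟨ψ.hom, ?_⟩
  have h : Ext.mk₀ (ModuleCat.ofHom f ≫ ψ) = Ext.mk₀ (ModuleCat.ofHom φ) := by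
    rw [← hx]; simp
  exact congrArg ModuleCat.Hom.hom ((Ext.mk₀_bijective _ _).1 h)

lemma subsingleton_ext_one {f : A →ₗ[R] B} {g : B →ₗ[R] C} (hf : Function.Injective f)
    (hfg : Function.Exact f g) (hg : Function.Surjective g) [Module.Projective R B]
    {Y : Type u} [AddCommGroup Y] [Module R Y]
    (h : ∀ φ : A →ₗ[R] Y, ∃ ψ : B →ₗ[R] Y, ψ ∘ₗ f = φ) :
    Subsingleton (Ext (ModuleCat.of R C) (ModuleCat.of R Y) 1) := by
  refine subsingleton_of_forall_eq 0 fun x ↦ ?_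
  obtain ⟨y, rfl⟩ := Ext.contravariant_sequence_exact₃ (shortExact_of hf hfg hg) _ x
    (Ext.eq_zero_of_projective _) (add_zero 1)
  obtain ⟨φ, rfl⟩ := (Ext.mk₀_bijective _ _).2 y
  obtain ⟨ψ, hψ⟩ := h φ.hom
  have : φ = ModuleCat.ofHom f ≫ ModuleCat.ofHom ψ := by
    rw [← ModuleCat.ofHom_comp, hψ]; rfl
  rw [this, ← Ext.mk₀_comp_mk₀]
  exact (shortExact_of hf hfg hg).extClass_comp_assoc _

lemma exists_surjective_ext_succ {f : A →ₗ[R] B} {g : B →ₗ[R] C} (hf : Function.Injective f)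
    (hfg : Function.Exact f g) (hg : Function.Surjective g) [Module.Projective R B]
    (Y : ModuleCat.{u} R) (n : ℕ) :
    ∃ δ : Ext (ModuleCat.of R A) Y n →ₗ[R] Ext (ModuleCat.of R C) Y (n + 1),
      Function.Surjective δ :=
  ⟨(shortExact_of hf hfg hg).extClass.precompOfLinear R Y (add_comm 1 n), fun x ↦
    Ext.contravariant_sequence_exact₃ (shortExact_of hf hfg hg) Y x
      (Ext.eq_zero_of_projective _) (add_comm 1 n)⟩

lemma subsingleton_ext_left {f : A →ₗ[R] B} {g : B →ₗ[R] C} (hf : Function.Injective f)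
    (hfg : Function.Exact f g) (hg : Function.Surjective g) [Module.Projective R B]
    {Y : ModuleCat.{u} R} {n : ℕ} (hC : Subsingleton (Ext (ModuleCat.of R C) Y (n + 1 + 1))) :
    Subsingleton (Ext (ModuleCat.of R A) Y (n + 1)) := by
  refine subsingleton_of_forall_eq 0 fun x ↦ ?_
  obtain ⟨y, rfl⟩ := extPrecomp_surjective hf hfg hg hC x
  rw [show y = 0 from Ext.eq_zero_of_projective _, map_zero]

lemma extPostcomp_injective_zero {f : A →ₗ[R] B} (hf : Function.Injective f)
    (X : ModuleCat.{u} R) : Function.Injective (extPostcomp f X 0) :=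
  have : Mono (ModuleCat.ofHom f) := (ModuleCat.mono_iff_injective _).2 hf
  Ext.postcomp_mk₀_injective_of_mono X (ModuleCat.ofHom f)

lemma extPostcomp_injective_succ {f : A →ₗ[R] B} {g : B →ₗ[R] C} (hf : Function.Injective f)
    (hfg : Function.Exact f g) (hg : Function.Surjective g) {X : ModuleCat.{u} R} {n : ℕ}
    (hC : Subsingleton (Ext X (ModuleCat.of R C) n)) :
    Function.Injective (extPostcomp f X (n + 1)) := by
  rw [injective_iff_map_eq_zero]
  intro x hx
  obtain ⟨y, rfl⟩ := Ext.covariant_sequence_exact₁ X (shortExact_of hf hfg hg) x hx rfl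
  rw [show y = 0 from Subsingleton.elim _ _, Ext.zero_comp]

lemma subsingleton_ext_of_subsingleton (N : Type u) [AddCommGroup N] [Module R N] [Subsingleton N]
    (Y : ModuleCat.{u} R) (n : ℕ) : Subsingleton (Ext (ModuleCat.of R N) Y n) := by
  refine subsingleton_of_forall_eq 0 fun x ↦ ?_
  have : 𝟙 (ModuleCat.of R N) = 0 := by
    ext y
    exact Subsingleton.elim (α := N) _ _
  rw [← Ext.mk₀_id_comp x, this, Ext.mk₀_zero, Ext.zero_comp]

lemma subsingleton_ext_congr (e : A ≃ₗ[R] B) (Y : ModuleCat.{u} R) (n : ℕ)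
    (h : Subsingleton (Ext (ModuleCat.of R B) Y n)) :
    Subsingleton (Ext (ModuleCat.of R A) Y n) :=
  subsingleton_ext_middle (f := (0 : PUnit.{u + 1} →ₗ[R] A)) (g := (e : A →ₗ[R] B))
    (fun _ _ _ ↦ Subsingleton.elim _ _) (fun x ↦ by simpa using ⟨Eq.symm, Eq.symm⟩) e.surjective
    (subsingleton_ext_of_subsingleton _ Y n) h

lemma extPrecomp_comp (g : B →ₗ[R] C) (f : A →ₗ[R] B) (Y : ModuleCat.{u} R) (n : ℕ) :
    extPrecomp (g ∘ₗ f) Y n = extPrecomp f Y n ∘ₗ extPrecomp g Y n := by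
  ext x
  exact Ext.mk₀_comp_mk₀_assoc (ModuleCat.ofHom f) (ModuleCat.ofHom g) x |>.symm

lemma extPostcomp_comp (g : B →ₗ[R] C) (f : A →ₗ[R] B) (X : ModuleCat.{u} R) (n : ℕ) :
    extPostcomp (g ∘ₗ f) X n = extPostcomp g X n ∘ₗ extPostcomp f X n := by
  ext x
  simp [ModuleCat.ofHom_comp, ← Ext.mk₀_comp_mk₀]

lemma extPrecomp_add (f g : A →ₗ[R] B) (Y : ModuleCat.{u} R) (n : ℕ) :
    extPrecomp (f + g) Y n = extPrecomp f Y n + extPrecomp g Y n := by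
  ext x
  simp [ModuleCat.ofHom_add, Ext.mk₀_add]

lemma extPostcomp_add (f g : A →ₗ[R] B) (X : ModuleCat.{u} R) (n : ℕ) :
    extPostcomp (f + g) X n = extPostcomp f X n + extPostcomp g X n := by
  ext x
  simp [ModuleCat.ofHom_add, Ext.mk₀_add]

lemma extPrecomp_smul_id (r : R) (Y : ModuleCat.{u} R) (n : ℕ) :
    extPrecomp (r • LinearMap.id : A →ₗ[R] A) Y n = r • LinearMap.id := by
  ext x
  have : ModuleCat.ofHom (r • LinearMap.id : A →ₗ[R] A) = r • 𝟙 (ModuleCat.of R A) := rfl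
  simp [this, Ext.mk₀_smul]

lemma extPostcomp_smul_id (r : R) (X : ModuleCat.{u} R) (n : ℕ) :
    extPostcomp (r • LinearMap.id : A →ₗ[R] A) X n = r • LinearMap.id := by
  ext x
  have : ModuleCat.ofHom (r • LinearMap.id : A →ₗ[R] A) = r • 𝟙 (ModuleCat.of R A) := rfl
  simp [this, Ext.mk₀_smul]

lemma extPrecomp_zero (Y : ModuleCat.{u} R) (n : ℕ) :
    extPrecomp (0 : A →ₗ[R] B) Y n = 0 := by
  simpa using extPrecomp_add (0 : A →ₗ[R] B) 0 Y n

lemma extPrecomp_sum {ι : Type*} (s : Finset ι) (f : ι → A →ₗ[R] B) (Y : ModuleCat.{u} R)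
    (n : ℕ) : extPrecomp (∑ i ∈ s, f i) Y n = ∑ i ∈ s, extPrecomp (f i) Y n :=
  map_sum (AddMonoidHom.mk' (fun f : A →ₗ[R] B ↦ extPrecomp f Y n)
    fun f g ↦ extPrecomp_add f g Y n) f s

lemma extPostcomp_sum {ι : Type*} (s : Finset ι) (f : ι → A →ₗ[R] B) (X : ModuleCat.{u} R)
    (n : ℕ) : extPostcomp (∑ i ∈ s, f i) X n = ∑ i ∈ s, extPostcomp (f i) X n :=
  map_sum (AddMonoidHom.mk' (fun f : A →ₗ[R] B ↦ extPostcomp f X n)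
    fun f g ↦ extPostcomp_add f g X n) f s

end ExtSequences

/-! ### Projectivity and splitting at a prime -/

section ProjectiveAt

variable {R : Type u} [CommRing R]

/-- `K` is projective at the ideal `p` if some element `r` outside `p` acts on `K` as an
endomorphism which factors through a finitely generated free module. -/
def IsProjectiveAt (p : Ideal R) (K : Type u) [AddCommGroup K] [Module R K] : Prop :=
  ∃ r ∉ p, ∃ (n : ℕ) (l : Fin n → Module.Dual R K) (k : Fin n → K),
    ∀ x, r • x = ∑ i, l i x • k i

variable {K : Type u} [AddCommGroup K] [Module R K]

lemma exists_dual_basis [Module.Finite R K] [Module.Projective R K] :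
    ∃ (n : ℕ) (l : Fin n → Module.Dual R K) (k : Fin n → K), ∀ x, x = ∑ i, l i x • k i := by
  obtain ⟨n, f, g, -, -, h⟩ := Module.Finite.exists_comp_eq_id_of_projective R K
  refine ⟨n, fun i ↦ LinearMap.proj i ∘ₗ g, fun i ↦ f fun j ↦ if i = j then 1 else 0,
    fun x ↦ ?_⟩
  have hx : f (g x) = x := LinearMap.congr_fun h x
  conv_lhs => rw [← hx, LinearMap.pi_apply_eq_sum_univ]
  rfl

lemma isProjectiveAt_of_projective {p : Ideal R} (hp : p ≠ ⊤) [Module.Finite R K]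
    [Module.Projective R K] : IsProjectiveAt p K := by
  obtain ⟨n, l, k, h⟩ := exists_dual_basis (R := R) (K := K)
  exact ⟨1, fun h ↦ hp ((Ideal.eq_top_iff_one p).2 h), n, l, k, fun x ↦ by simpa using h x⟩

lemma smul_id_eq_sum {r : R} {n : ℕ} {l : Fin n → Module.Dual R K} {k : Fin n → K}
    (h : ∀ x, r • x = ∑ i, l i x • k i) :
    (r • LinearMap.id : K →ₗ[R] K) = ∑ i, LinearMap.toSpanSingleton R K (k i) ∘ₗ l i := by
  ext x
  simp [h]

lemma smul_ext_eq_zero_of_smul_eq_sum {r : R} {n : ℕ} {l : Fin n → Module.Dual R K}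
    {k : Fin n → K} (h : ∀ x, r • x = ∑ i, l i x • k i) {Y : ModuleCat.{u} R} {m : ℕ}
    (x : Ext (ModuleCat.of R K) Y (m + 1)) : r • x = 0 := by
  have := LinearMap.congr_fun (extPrecomp_smul_id (A := K) r Y (m + 1)) x
  rw [smul_id_eq_sum h, extPrecomp_sum] at this
  simp only [extPrecomp_comp] at this
  have h0 : ∀ y : Ext (ModuleCat.of R R) Y (m + 1), y = 0 := Ext.eq_zero_of_projective
  rw [LinearMap.smul_apply, LinearMap.id_apply] at this
  rw [← this, LinearMap.sum_apply]
  refine Finset.sum_eq_zero fun i _ ↦ ?_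
  rw [LinearMap.comp_apply, h0 (extPrecomp _ Y (m + 1) x), map_zero]

lemma subsingleton_ext_of_projective [Module.Finite R K] [Module.Projective R K]
    {X : ModuleCat.{u} R} {m : ℕ} (hX : Subsingleton (Ext X (ModuleCat.of R R) m)) :
    Subsingleton (Ext X (ModuleCat.of R K) m) := by
  obtain ⟨n, l, k, h⟩ := exists_dual_basis (R := R) (K := K)
  refine subsingleton_of_forall_eq 0 fun x ↦ ?_
  have := LinearMap.congr_fun (extPostcomp_smul_id (A := K) (1 : R) X m) x
  rw [smul_id_eq_sum (l := l) (k := k) (fun x ↦ by rw [one_smul]; exact h x),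
    extPostcomp_sum] at this
  simp only [extPostcomp_comp] at this
  rw [one_smul, LinearMap.id_apply] at this
  rw [← this, LinearMap.sum_apply]
  refine Finset.sum_eq_zero fun i _ ↦ ?_
  rw [LinearMap.comp_apply, show extPostcomp (l i) X m x = 0 from Subsingleton.elim _ _, map_zero]

variable {F : Type u} [AddCommGroup F] [Module R F]

/-- A linear endomorphism `a • id` of a finite module with image in `p N` gives an element
outside `p` killing `N`, if `a ∉ p`. -/
lemma exists_notMem_smul_eq_zero {p : Ideal R} [p.IsPrime] {N : Type u} [AddCommGroup N]
    [Module R N] [Module.Finite R N] {a : R} (ha : a ∉ p)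
    (h : ∀ x : N, a • x ∈ p • (⊤ : Submodule R N)) : ∃ u ∉ p, ∀ x : N, u • x = 0 := by
  obtain ⟨P, hP, -, hc, h0⟩ :=
    LinearMap.exists_monic_and_natDegree_eq_and_coeff_mem_pow_and_aeval_eq_zero R
      (a • LinearMap.id : N →ₗ[R] N) p (by rintro _ ⟨x, rfl⟩; exact h x)
  -- By Cayley–Hamilton `P(a)` kills `N`; as `P` is monic with lower coefficients in `p`, `P(a)` is
  -- a power of `a` modulo `p`.
  refine ⟨P.eval a, fun hPa ↦ ?_, fun x ↦ ?_⟩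
  · rw [Polynomial.eval_eq_sum_range, Finset.sum_range_succ, hP.coeff_natDegree, one_mul,
      Ideal.add_mem_iff_right] at hPa
    · exact ha (Ideal.IsPrime.mem_of_pow_mem ‹_› _ hPa)
    · refine Ideal.sum_mem _ fun k hk ↦ Ideal.mul_mem_right _ _ ?_
      exact Ideal.pow_le_self (by have := Finset.mem_range.1 hk; omega) (hc k)
  · have := LinearMap.congr_fun h0 x
    have ha : (a • LinearMap.id : N →ₗ[R] N) = algebraMap R (Module.End R N) a := rfl
    rw [ha, Polynomial.aeval_algebraMap_apply] at this
    simpa using this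

/-- Stands in for the local fact that a map from a free module is split injective once it is
injective modulo the maximal ideal. A maximal submodule `D` on which `ι` splits up to a scalar
outside `p` is shown to be all of `K` at `p`, by Nakayama. -/
lemma exists_retraction_at {p : Ideal R} [p.IsPrime] [IsNoetherianRing R] [Module.Finite R K]
    (hK : IsProjectiveAt p K) (ι : K →ₗ[R] F)
    (h : ∀ (v : K) (l : Module.Dual R K), l v ∉ p → ∃ μ : Module.Dual R F, μ (ι v) ∉ p) :
    ∃ u ∉ p, ∃ ρ : F →ₗ[R] K, ∀ x, ρ (ι x) = u • x := by
  have hp1 : (1 : R) ∉ p := fun h ↦ Ideal.IsPrime.ne_top ‹_› ((Ideal.eq_top_iff_one p).2 h)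
  let S : Set (Submodule R K) := {D | ∃ ρ : F →ₗ[R] K, (∀ y, ρ y ∈ D) ∧
    ∃ s ∉ p, ∀ d ∈ D, ρ (ι d) = s • d}
  have hS : S.Nonempty := ⟨⊥, 0, by simp, 1, hp1, by simp⟩
  obtain ⟨D, ⟨ρ, hρ, s, hs, hρs⟩, hD⟩ := set_has_maximal_iff_noetherian.2
    (inferInstance : IsNoetherian R K) S hS
  have key (x : K) (l : Module.Dual R K) : l (s • x - ρ (ι x)) ∈ p := by
    by_contra hl
    obtain ⟨μ, hμ⟩ := h _ l hl
    set v := s • x - ρ (ι x) with hv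
    have hρv : ρ (ι v) = 0 := by
      simp [hv, hρs _ (hρ (ι x))]
    have hsc : s * μ (ι v) ∉ p := fun hmem ↦
      (Ideal.IsPrime.mem_or_mem ‹_› hmem).elim hs hμ
    -- The correction makes the functional vanish on `ι(D)` and only multiplies its value at `ι v`
    -- by `s`, so the splitting extends to `D + R v`.
    let μ' : Module.Dual R F := s • μ - μ ∘ₗ ι ∘ₗ ρ
    have hμ'v : μ' (ι v) = s * μ (ι v) := by simp [μ', hρv]
    have hμ'D (d) (hd : d ∈ D) : μ' (ι d) = 0 := by simp [μ', hρs d hd]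
    have hmem : D ⊔ Submodule.span R {v} ∈ S := by
      refine ⟨(s * μ (ι v)) • ρ + (s • μ').smulRight v, fun y ↦ ?_,
        s * (s * μ (ι v)), fun hm ↦ (Ideal.IsPrime.mem_or_mem ‹_› hm).elim hs hsc, ?_⟩
      · exact add_mem (Submodule.smul_mem _ _ (Submodule.mem_sup_left (hρ y)))
          (Submodule.smul_mem _ _ (Submodule.mem_sup_right (Submodule.mem_span_singleton_self v)))
      · intro d' hd'
        obtain ⟨d, hd, w, hw, rfl⟩ := Submodule.mem_sup.1 hd'
        obtain ⟨c, rfl⟩ := Submodule.mem_span_singleton.1 hw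
        simp only [LinearMap.add_apply, LinearMap.smul_apply, map_add, map_smul, hρs d hd, hρv,
          LinearMap.smulRight_apply, hμ'v, hμ'D d hd, smul_eq_mul]
        module
    have hvD : v ∈ D := by
      have := (le_sup_left (a := D)).eq_of_not_lt (hD _ hmem)
      rw [this]
      exact Submodule.mem_sup_right (Submodule.mem_span_singleton_self v)
    have h0 : s • v = 0 := by rw [← hρs v hvD, hρv]
    have : s * l v ∈ p := by
      rw [← smul_eq_mul, ← map_smul, h0, map_zero]
      exact p.zero_mem
    exact (Ideal.IsPrime.mem_or_mem ‹_› this).elim hs hl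
  obtain ⟨r, hr, n, l, k, hK⟩ := hK
  have hrs : r * s ∉ p := fun hm ↦ (Ideal.IsPrime.mem_or_mem ‹_› hm).elim hr hs
  -- By `key` and projectivity at `p`, `r s K ⊆ D + p K`.
  obtain ⟨u, hu, hu0⟩ := exists_notMem_smul_eq_zero (N := K ⧸ D) hrs (by
    intro y
    obtain ⟨x, rfl⟩ := D.mkQ_surjective y
    have h1 : (r * s) • D.mkQ x = D.mkQ (r • (s • x - ρ (ι x))) := by
      have : D.mkQ (ρ (ι x)) = 0 := by simpa using hρ (ι x)
      rw [map_smul, map_sub, this, sub_zero, map_smul, mul_smul]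
    rw [h1, hK, map_sum]
    refine Submodule.sum_mem _ fun i _ ↦ ?_
    rw [map_smul]
    exact Submodule.smul_mem_smul (key x (l i)) trivial)
  refine ⟨s * u, fun hm ↦ (Ideal.IsPrime.mem_or_mem ‹_› hm).elim hs hu, u • ρ, fun x ↦ ?_⟩
  have hux : u • x ∈ D := by
    rw [← Submodule.Quotient.mk_eq_zero, Submodule.Quotient.mk_smul, hu0]
  rw [LinearMap.smul_apply, ← map_smul, ← map_smul, hρs _ hux, mul_smul]

/-- If `0 → K → F → N → 0` is exact with `F` finite projective and `K → F` splits at `p`, then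
`N` is projective at `p`. -/
lemma isProjectiveAt_of_retraction {p : Ideal R} [p.IsPrime] {N : Type u} [AddCommGroup N]
    [Module R N] [Module.Finite R F] [Module.Projective R F] {ι : K →ₗ[R] F} {q : F →ₗ[R] N}
    (hq : Function.Surjective q) (hιq : Function.Exact ι q) {u : R} (hu : u ∉ p)
    {ρ : F →ₗ[R] K} (hρ : ∀ x, ρ (ι x) = u • x) : IsProjectiveAt p N := by
  -- This kills the image of `ι`, so it descends to `σ : N → F` with `q ∘ σ = u`; thus `u` factors
  -- through `F`.
  let τ : F →ₗ[R] F := u • LinearMap.id - ι ∘ₗ ρ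
  obtain ⟨σ, hσ⟩ := exists_factor_of_surjective hq τ fun y hy ↦ by
    obtain ⟨x, rfl⟩ := (hιq y).1 hy
    simp [τ, hρ]
  obtain ⟨n, l, k, h⟩ := exists_dual_basis (R := R) (K := F)
  refine ⟨u, hu, n, fun i ↦ l i ∘ₗ σ, fun i ↦ q (k i), fun x ↦ ?_⟩
  obtain ⟨y, rfl⟩ := hq x
  have h2 : q (τ y) = u • q y := by
    simp [τ, hιq.apply_apply_eq_zero]
  rw [← h2]
  conv_lhs => rw [h (τ y)]
  simp [hσ]

end ProjectiveAt

/-! ### Choosing a prime that detects the depth -/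

section PrimeChoice

variable {R : Type u} [CommRing R]

/-- The ideal `p` is a *depth witness* in degree `d` if `Ext^l_R(R/p, R)` vanishes for `l < d`, and
`Ext^d_R(R/p, R)` is nonzero, with all elements outside `p` acting on it as nonzerodivisors. -/
structure IsDepthWitness (p : Ideal R) (d : ℕ) : Prop where
  subsingleton : ∀ l < d, Subsingleton (Ext (ModuleCat.of R (R ⧸ p)) (ModuleCat.of R R) l)
  nontrivial : Nontrivial (Ext (ModuleCat.of R (R ⧸ p)) (ModuleCat.of R R) d)
  eq_zero_of_smul : ∀ a ∉ p, ∀ e : Ext (ModuleCat.of R (R ⧸ p)) (ModuleCat.of R R) d,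
    a • e = 0 → e = 0

/-- Dévissage along a prime filtration; every prime that occurs contains the annihilator. -/
lemma subsingleton_ext_of_forall_prime [IsNoetherianRing R] (N : Type u) [AddCommGroup N]
    [Module R N] [hN : Module.Finite R N] {I : Ideal R} (hI : I ≤ Module.annihilator R N)
    (Y : ModuleCat.{u} R) (n : ℕ)
    (h : ∀ p : Ideal R, p.IsPrime → I ≤ p → Subsingleton (Ext (ModuleCat.of R (R ⧸ p)) Y n)) :
    Subsingleton (Ext (ModuleCat.of R N) Y n) := by
  revert hI
  induction hN using IsNoetherianRing.induction_on_isQuotientEquivQuotientPrime R with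
  | subsingleton N => exact fun _ ↦ subsingleton_ext_of_subsingleton N Y n
  | quotient N p e =>
    intro hI
    rw [e.annihilator_eq, Ideal.annihilator_quotient] at hI
    exact subsingleton_ext_congr e Y n (h p.1 p.2 hI)
  | exact N₁ N₂ N₃ f g hf hg hfg h₁ h₃ =>
    intro hI
    exact subsingleton_ext_middle hf hfg hg (h₁ (hI.trans (f.annihilator_le_of_injective hf)))
      (h₃ (hI.trans (g.annihilator_le_of_surjective hg)))

lemma exists_isDepthWitness [IsNoetherianRing R] (E : Type u) [AddCommGroup E]
    [Module R E] [Module.Finite R E] {j : ℕ}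
    (hE : Nontrivial (Ext (ModuleCat.of R E) (ModuleCat.of R R) j)) :
    ∃ p : Ideal R, p.IsPrime ∧ Module.annihilator R E ≤ p ∧ ∃ d ≤ j, IsDepthWitness p d := by
  classical
  let I := Module.annihilator R E
  let S (d : ℕ) : Set (Ideal R) := {q | q.IsPrime ∧ I ≤ q ∧
    Nontrivial (Ext (ModuleCat.of R (R ⧸ q)) (ModuleCat.of R R) d)}
  have hj : (S j).Nonempty := by
    by_contra hS
    refine not_subsingleton_iff_nontrivial.2 hE
      (subsingleton_ext_of_forall_prime E le_rfl _ _ fun p hp hIp ↦ ?_)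
    by_contra hn
    exact hS ⟨p, hp, hIp, not_subsingleton_iff_nontrivial.1 hn⟩
  have hex : ∃ d, (S d).Nonempty := ⟨j, hj⟩
  -- The degree is taken minimal first, then the prime maximal for that degree.
  obtain ⟨p, ⟨hp, hIp, hpd⟩, hmax⟩ := set_has_maximal_iff_noetherian.2
    (inferInstance : IsNoetherian R R) _ (Nat.find_spec hex)
  refine ⟨p, hp, hIp, Nat.find hex, Nat.find_min' hex hj, fun l hl ↦ ?_, hpd, fun a ha e he ↦ ?_⟩
  · by_contra hn
    exact Nat.find_min hex hl ⟨p, hp, hIp, not_subsingleton_iff_nontrivial.1 hn⟩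
  · let f : (R ⧸ p) →ₗ[R] (R ⧸ p) := a • LinearMap.id
    have hf : Function.Injective f := by
      rw [injective_iff_map_eq_zero]
      intro x hx
      obtain ⟨x, rfl⟩ := Ideal.Quotient.mk_surjective x
      have hx' : Ideal.Quotient.mk p (a * x) = 0 := hx
      rw [Ideal.Quotient.eq_zero_iff_mem] at hx' ⊢
      exact (hp.mem_or_mem hx').resolve_left ha
    -- The primes in a filtration of `R/(p + (a))` strictly contain `p`, so maximality kills their
    -- `Ext` in this degree.
    have hC : Subsingleton (Ext (ModuleCat.of R ((R ⧸ p) ⧸ LinearMap.range f))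
        (ModuleCat.of R R) (Nat.find hex)) := by
      refine subsingleton_ext_of_forall_prime _ (I := p ⊔ Ideal.span {a}) ?_ _ _
        fun q hq hpq ↦ ?_
      · rw [sup_le_iff, Ideal.span_singleton_le_iff_mem]
        refine ⟨fun b hb ↦ ?_, ?_⟩
        · rw [Module.mem_annihilator]
          intro m
          obtain ⟨m, rfl⟩ := Submodule.mkQ_surjective _ m
          obtain ⟨m, rfl⟩ := Ideal.Quotient.mk_surjective m
          rw [← map_smul]
          have : b • (Ideal.Quotient.mk p m) = 0 :=
            Ideal.Quotient.eq_zero_iff_mem.2 (Ideal.mul_mem_right _ p hb)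
          rw [this, map_zero]
        · rw [Module.mem_annihilator]
          intro m
          obtain ⟨m, rfl⟩ := Submodule.mkQ_surjective _ m
          rw [← map_smul, Submodule.mkQ_apply, Submodule.Quotient.mk_eq_zero]
          exact ⟨m, rfl⟩
      · by_contra hn
        have hlt : p < q := by
          refine lt_of_le_of_ne (le_sup_left.trans hpq) ?_
          rintro rfl
          exact ha (hpq (Submodule.mem_sup_right (Ideal.mem_span_singleton_self a)))
        exact hmax q ⟨hq, hIp.trans hlt.le, not_subsingleton_iff_nontrivial.1 hn⟩ hlt
    have hinj := extPrecomp_injective hf (LinearMap.exact_map_mkQ_range f)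
      (Submodule.mkQ_surjective _) hC
    apply hinj
    rw [map_zero, extPrecomp_smul_id]
    exact he

/-! ### Auslander–Buchsbaum at the chosen prime -/

lemma smul_ext_quotient_eq_zero {p : Ideal R} {a : R} (ha : a ∈ p) (Y : ModuleCat.{u} R) (n : ℕ)
    (e : Ext (ModuleCat.of R (R ⧸ p)) Y n) : a • e = 0 := by
  have h : (a • LinearMap.id : (R ⧸ p) →ₗ[R] (R ⧸ p)) = 0 := by
    ext
    simpa [Algebra.smul_def] using Ideal.Quotient.eq_zero_iff_mem.2 ha
  have := LinearMap.congr_fun (extPrecomp_smul_id (A := R ⧸ p) a Y n) e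
  rw [h, extPrecomp_zero] at this
  simpa using this.symm

/-- Otherwise `ι v` has all its coordinates in `p`, which annihilates `Ext^d(R/p, -)`. By
injectivity `v : R → K` then induces zero on a nonzero class `e` of `Ext^d(R/p, R)`, and applying
`l` gives `l(v) e = 0`. -/
lemma IsDepthWitness.exists_dual_notMem {p : Ideal R} {d : ℕ} (hp : IsDepthWitness p d)
    {K F : Type u} [AddCommGroup K] [Module R K] [AddCommGroup F] [Module R F]
    [Module.Finite R F] [Module.Projective R F] {ι : K →ₗ[R] F}
    (hι : Function.Injective (extPostcomp ι (ModuleCat.of R (R ⧸ p)) d))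
    {v : K} {l : Module.Dual R K} (hl : l v ∉ p) : ∃ μ : Module.Dual R F, μ (ι v) ∉ p := by
  by_contra! h
  have := hp.nontrivial
  obtain ⟨e, he⟩ := exists_ne (0 : Ext (ModuleCat.of R (R ⧸ p)) (ModuleCat.of R R) d)
  obtain ⟨n, m, k, hF⟩ := exists_dual_basis (R := R) (K := F)
  have h1 : ι ∘ₗ LinearMap.toSpanSingleton R K v =
      ∑ i, LinearMap.toSpanSingleton R F (k i) ∘ₗ (m i (ι v) • LinearMap.id) := by
    ext
    simpa using hF (ι v)
  have h2 : l ∘ₗ LinearMap.toSpanSingleton R K v = l v • LinearMap.id := by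
    ext
    simp
  have h3 : extPostcomp (LinearMap.toSpanSingleton R K v) (ModuleCat.of R (R ⧸ p)) d e = 0 := by
    apply hι
    rw [map_zero, ← LinearMap.comp_apply, ← extPostcomp_comp, h1, extPostcomp_sum,
      LinearMap.sum_apply]
    refine Finset.sum_eq_zero fun i _ ↦ ?_
    rw [extPostcomp_comp, extPostcomp_smul_id, LinearMap.comp_apply, LinearMap.smul_apply,
      smul_ext_quotient_eq_zero (h (m i)), map_zero]
  refine he (hp.eq_zero_of_smul _ hl e ?_)
  have h4 := congrArg (extPostcomp l (ModuleCat.of R (R ⧸ p)) d) h3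
  rw [map_zero, ← LinearMap.comp_apply, ← extPostcomp_comp, h2, extPostcomp_smul_id] at h4
  exact h4

/-- In an exact sequence `0 → K → F → N → 0` with `F` finite projective, the module `K` has
one more vanishing `Ext^l(R/p, -)` than `N`, as long as this is at most the number for `R`. -/
lemma IsDepthWitness.subsingleton_ext_left {p : Ideal R} {d : ℕ} (hp : IsDepthWitness p d)
    {K F N : Type u} [AddCommGroup K] [Module R K] [AddCommGroup F] [Module R F]
    [AddCommGroup N] [Module R N] [Module.Finite R F] [Module.Projective R F]
    {ι : K →ₗ[R] F} {q : F →ₗ[R] N} (hι : Function.Injective ι) (hιq : Function.Exact ι q)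
    (hq : Function.Surjective q) {j : ℕ} (hj : j < d)
    (hN : ∀ l < j, Subsingleton (Ext (ModuleCat.of R (R ⧸ p)) (ModuleCat.of R N) l)) :
    ∀ l < j + 1, Subsingleton (Ext (ModuleCat.of R (R ⧸ p)) (ModuleCat.of R K) l) := by
  intro l hl
  have hF := subsingleton_ext_of_projective (K := F) (hp.subsingleton l (by omega))
  cases l with
  | zero => exact (extPostcomp_injective_zero hι _).subsingleton
  | succ l => exact (extPostcomp_injective_succ hι hιq hq (hN l (by omega))).subsingleton

lemma hasProjectiveDimensionLT_ker {K F : Type u} [AddCommGroup K] [Module R K] [AddCommGroup F]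
    [Module R F] [Module.Projective R F] {q : F →ₗ[R] K} (hq : Function.Surjective q) {n : ℕ}
    (h : HasProjectiveDimensionLT (ModuleCat.of R K) (n + 2)) :
    HasProjectiveDimensionLT (ModuleCat.of R (LinearMap.ker q)) (n + 1) :=
  ((shortExact_of (LinearMap.ker q).subtype_injective q.exact_subtype_ker_map hq
    ).hasProjectiveDimensionLT_X₃_iff n (inferInstanceAs (Projective (ModuleCat.of R F)))).1 h

/-- A finite module of finite projective dimension whose depth at `p` is at least that of the
ring is projective at `p`. -/
lemma IsDepthWitness.isProjectiveAt [IsNoetherianRing R] {p : Ideal R} [p.IsPrime] {d : ℕ}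
    (hp : IsDepthWitness p d) {n : ℕ} (K : Type u) [AddCommGroup K] [Module R K]
    [Module.Finite R K] (hn : HasProjectiveDimensionLT (ModuleCat.of R K) (n + 1))
    (hK : ∀ l < d, Subsingleton (Ext (ModuleCat.of R (R ⧸ p)) (ModuleCat.of R K) l)) :
    IsProjectiveAt p K := by
  induction n generalizing K with
  | zero =>
    have : Projective (ModuleCat.of R K) := inferInstance
    have : Module.Projective R K := IsProjective.iff_projective _ |>.2 this
    exact isProjectiveAt_of_projective (Ideal.IsPrime.ne_top ‹_›)
  | succ n ih =>
    obtain ⟨F, _, _, _, _, q, hq⟩ := Module.exists_finite_presentation R K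
    have hker := (LinearMap.ker q).subtype_injective
    have hex := q.exact_subtype_ker_map
    have hK' : ∀ l < d, Subsingleton
        (Ext (ModuleCat.of R (R ⧸ p)) (ModuleCat.of R (LinearMap.ker q)) l) := by
      intro l hl
      exact hp.subsingleton_ext_left hker hex hq (j := l) hl (fun l' hl' ↦ hK l' (by omega)) l
        (by omega)
    have hP := ih (LinearMap.ker q) (hasProjectiveDimensionLT_ker hq hn) hK'
    have hinj : Function.Injective
        (extPostcomp (LinearMap.ker q).subtype (ModuleCat.of R (R ⧸ p)) d) := by
      cases d with
      | zero => exact extPostcomp_injective_zero hker _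
      | succ d => exact extPostcomp_injective_succ hker hex hq (hK d (by omega))
    obtain ⟨u, hu, ρ, hρ⟩ := exists_retraction_at hP (LinearMap.ker q).subtype
      fun v l hl ↦ hp.exists_dual_notMem hinj hl
    exact isProjectiveAt_of_retraction hq hex hu hρ

/-- Each syzygy raises the depth by one until it reaches `d`; the `i`th syzygy is then projective at
`p`, and dimension shifting gives the claim. The integer `n` only records finiteness. -/
lemma IsDepthWitness.exists_smul_ext_eq_zero [IsNoetherianRing R] {p : Ideal R} [p.IsPrime] {d : ℕ}
    (hp : IsDepthWitness p d) {n : ℕ} (W : Type u) [AddCommGroup W] [Module R W]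
    [Module.Finite R W] (hn : HasProjectiveDimensionLT (ModuleCat.of R W) (n + 1)) {i j : ℕ}
    (hij : i + j = d)
    (hW : ∀ l < j, Subsingleton (Ext (ModuleCat.of R (R ⧸ p)) (ModuleCat.of R W) l))
    (Y : ModuleCat.{u} R) (m : ℕ) (hm : i < m) :
    ∃ r ∉ p, ∀ x : Ext (ModuleCat.of R W) Y m, r • x = 0 := by
  induction i generalizing W j n m with
  | zero =>
    obtain rfl : j = d := by omega
    obtain ⟨r, hr, t, l, k, h⟩ := hp.isProjectiveAt W hn hW
    obtain ⟨m, rfl⟩ := Nat.exists_eq_add_one_of_ne_zero hm.ne'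
    exact ⟨r, hr, smul_ext_eq_zero_of_smul_eq_sum h⟩
  | succ i ih =>
    obtain ⟨F, _, _, _, _, q, hq⟩ := Module.exists_finite_presentation R W
    have hker := (LinearMap.ker q).subtype_injective
    have hex := q.exact_subtype_ker_map
    obtain ⟨m, rfl⟩ := Nat.exists_eq_add_one_of_ne_zero (by omega : m ≠ 0)
    have : HasProjectiveDimensionLT (ModuleCat.of R W) (n + 2) :=
      hasProjectiveDimensionLT_of_ge _ (n + 1) _ (by omega)
    obtain ⟨r, hr, h⟩ := ih (LinearMap.ker q) (hasProjectiveDimensionLT_ker hq this)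
      (j := j + 1) (by omega) (hp.subsingleton_ext_left hker hex hq (by omega) hW) m (by omega)
    obtain ⟨δ, hδ⟩ := exists_surjective_ext_succ hker hex hq Y m
    refine ⟨r, hr, fun x ↦ ?_⟩
    obtain ⟨y, rfl⟩ := hδ x
    rw [← map_smul, h, map_zero]

/-- If `W` is a finite module of finite projective dimension over a noetherian ring, then
`Ext^j(Ext^i(W, R), R) = 0` for `j < i`. -/
lemma subsingleton_ext_ext_of_hasProjectiveDimensionLT [IsNoetherianRing R] {n : ℕ} (W : Type u)
    [AddCommGroup W] [Module R W] [Module.Finite R W]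
    (hn : HasProjectiveDimensionLT (ModuleCat.of R W) (n + 1)) {i j : ℕ} (hji : j < i) :
    Subsingleton (Ext (ModuleCat.of R (Ext (ModuleCat.of R W) (ModuleCat.of R R) i))
      (ModuleCat.of R R) j) := by
  by_contra hE
  obtain ⟨p, hp, hIp, d, hd, hw⟩ := exists_isDepthWitness _ (not_subsingleton_iff_nontrivial.1 hE)
  -- With `j = 0` nothing is assumed on the depth of `W`; `d < i` suffices.
  obtain ⟨r, hr, h⟩ := hw.exists_smul_ext_eq_zero W hn (i := d) (j := 0) (by omega) (by simp)
    (ModuleCat.of R R) i (by omega)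
  exact hr (hIp (Module.mem_annihilator.2 h))

end PrimeChoice

/-! ### Coresolutions of torsionfree modules -/

section Torsionfree

variable {R : Type u} [CommRing R]

/-- `HasDualExactCoresolution m X`: there is an exact sequence `0 → X → Q₁ → ⋯ → Q_m` of finite
projective modules `Q_i` whose dual `Q_m^* → ⋯ → Q₁^* → X^* → 0` is exact at `X^*` and at the
duals `Q_i^*`, `i < m`. -/
def HasDualExactCoresolution : ℕ → ModuleCat.{u} R → Prop
  | 0, _ => True
  | m + 1, X => ∃ (Q V : ModuleCat.{u} R) (f : X →ₗ[R] Q) (g : Q →ₗ[R] V),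
      Module.Finite R Q ∧ Module.Projective R Q ∧ Function.Injective f ∧ Function.Exact f g ∧
      Function.Surjective g ∧ (∀ φ : Module.Dual R X, ∃ ψ : Module.Dual R Q, ψ ∘ₗ f = φ) ∧
      HasDualExactCoresolution m V

lemma exists_dual_extension_to_finite_free [IsNoetherianRing R] (X : Type u) [AddCommGroup X]
    [Module R X] [Module.Finite R X] : ∃ (t : ℕ) (f : X →ₗ[R] (Fin t → R)),
      ∀ φ : Module.Dual R X, ∃ ψ : Module.Dual R (Fin t → R), ψ ∘ₗ f = φ := by
  obtain ⟨t, s, hs⟩ := Module.Finite.exists_fin (R := R) (M := Module.Dual R X)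
  refine ⟨t, LinearMap.pi s, fun φ ↦ ?_⟩
  obtain ⟨c, rfl⟩ := (Submodule.mem_span_range_iff_exists_fun R).1
    (hs ▸ Submodule.mem_top : φ ∈ Submodule.span R (Set.range s))
  refine ⟨∑ i, c i • LinearMap.proj i, ?_⟩
  ext x
  simp

/-- Evaluation at a lift `p` of `x` vanishes on `X^* = Ker ∂^*`, so it descends to `Im ∂^*`. It
extends to `P₁^*` because `Ext^1(Tr X, R) = 0`, and reflexivity turns the extension into a `b` with
`∂ b = p`. -/
lemma ProjPresentation.eq_zero_of_forall_dual_eq_zero {X : ModuleCat.{u} R} (P : ProjPresentation X)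
    (h : Subsingleton (Ext P.transpose (ModuleCat.of R R) 1)) {x : X}
    (hx : ∀ φ : Module.Dual R X, φ x = 0) : x = 0 := by
  have := P.finite_P₀; have := P.finite_P₁; have := P.projective_P₀; have := P.projective_P₁
  obtain ⟨p, rfl⟩ := P.surjective x
  obtain ⟨σ, hσ⟩ := exists_factor_of_surjective
    (A := Module.Dual R P.P₀) (B := LinearMap.range P.d.dualMap) (C := R)
    P.d.dualMap.surjective_rangeRestrict (Module.Dual.eval R P.P₀ p) fun φ hφ ↦ by
      have hφ' : φ ∘ₗ P.d = 0 := congrArg Subtype.val hφ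
      obtain ⟨φ', hφ'⟩ := exists_factor_of_surjective P.surjective φ fun a ha ↦ by
        obtain ⟨b, rfl⟩ := (P.exact a).1 ha
        exact LinearMap.congr_fun hφ' b
      rw [Module.Dual.eval_apply, ← hφ', hx]
  obtain ⟨ψ, hψ⟩ := exists_extension_of_subsingleton_ext
    (LinearMap.range P.d.dualMap).subtype_injective
    (LinearMap.exact_subtype_mkQ _) (Submodule.mkQ_surjective _) h σ
  obtain ⟨b, rfl⟩ := (Module.bijective_dual_eval R P.P₁).2 ψ
  have hb : P.d b = p := (Module.bijective_dual_eval R P.P₀).1 <| by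
    ext φ
    rw [← hσ φ, ← hψ]
    rfl
  rw [← hb, P.exact.apply_apply_eq_zero]

lemma ProjPresentation.hasDualExactCoresolution [IsNoetherianRing R] {m : ℕ} {X : ModuleCat.{u} R}
    (P : ProjPresentation X) (h : ∀ i : ℕ, 1 ≤ i → i ≤ m →
      Subsingleton (Ext P.transpose (ModuleCat.of R R) i)) : HasDualExactCoresolution m X := by
  induction m generalizing X with
  | zero => trivial
  | succ m ih =>
    have := P.finite_P₀; have := P.finite_P₁; have := P.projective_P₀; have := P.projective_P₁
    have : Module.Finite R X := Module.Finite.of_surjective P.π P.surjective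
    obtain ⟨t, f, hf⟩ := exists_dual_extension_to_finite_free (R := R) X
    have hinj : Function.Injective f := by
      rw [injective_iff_map_eq_zero]
      refine fun x hx ↦ P.eq_zero_of_forall_dual_eq_zero (h 1 le_rfl (by omega)) fun φ ↦ ?_
      obtain ⟨ψ, rfl⟩ := hf φ
      rw [LinearMap.comp_apply, hx, map_zero]
    have hexact := LinearMap.exact_map_mkQ_range f
    have hsurj := Submodule.mkQ_surjective (LinearMap.range f)
    refine ⟨ModuleCat.of R (Fin t → R), ModuleCat.of R ((Fin t → R) ⧸ LinearMap.range f), f,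
      (LinearMap.range f).mkQ, inferInstanceAs (Module.Finite R (Fin t → R)),
      inferInstanceAs (Module.Projective R (Fin t → R)), hinj, hexact, hsurj, hf, ?_⟩
    -- With this presentation the transpose of the cokernel is `P₀^* / X^* ≅ Im ∂^*`, a syzygy of
    -- `Tr X`, so its `Ext` vanishing is that of `Tr X` shifted by one degree.
    let P' : ProjPresentation (ModuleCat.of R ((Fin t → R) ⧸ LinearMap.range f)) :=
      { P₁ := P.P₀
        P₀ := ModuleCat.of R (Fin t → R)
        finite_P₁ := P.finite_P₀
        finite_P₀ := inferInstanceAs (Module.Finite R (Fin t → R))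
        projective_P₁ := P.projective_P₀
        projective_P₀ := inferInstanceAs (Module.Projective R (Fin t → R))
        d := f ∘ₗ P.π
        π := (LinearMap.range f).mkQ
        exact := fun y ↦ (hexact y).trans
          ⟨fun ⟨x, hx⟩ ↦ (P.surjective x).imp fun a ha ↦ by simp [ha, hx],
            fun ⟨a, ha⟩ ↦ ⟨P.π a, ha⟩⟩
        surjective := hsurj }
    refine ih P' fun i hi him ↦ ?_
    have hker (φ : Module.Dual R P.P₀) :
        P.d.dualMap φ = 0 ↔ φ ∈ LinearMap.range P'.d.dualMap := by
      constructor
      · intro hφ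
        obtain ⟨φ', hφ'⟩ := exists_factor_of_surjective P.surjective φ fun a ha ↦ by
          obtain ⟨b, rfl⟩ := (P.exact a).1 ha
          exact LinearMap.congr_fun hφ b
        obtain ⟨ψ, rfl⟩ := hf φ'
        exact ⟨ψ, LinearMap.ext hφ'⟩
      · rintro ⟨ψ, rfl⟩
        ext b
        change ψ (f (P.π (P.d b))) = 0
        rw [P.exact.apply_apply_eq_zero, map_zero, map_zero]
    let j := (LinearMap.range P'.d.dualMap).liftQ P.d.dualMap fun φ hφ ↦ (hker φ).2 hφ
    have hj : Function.Injective j := by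
      rw [injective_iff_map_eq_zero]
      intro y hy
      obtain ⟨φ, rfl⟩ := Submodule.mkQ_surjective _ y
      exact (Submodule.Quotient.mk_eq_zero _).2 ((hker φ).1 hy)
    have hjq : Function.Exact j (LinearMap.range P.d.dualMap).mkQ := by
      rw [LinearMap.exact_iff, Submodule.ker_mkQ]
      exact (Submodule.range_liftQ _ _ _).symm
    obtain ⟨i, rfl⟩ := Nat.exists_eq_add_one_of_ne_zero (by omega : i ≠ 0)
    exact subsingleton_ext_left hj hjq (Submodule.mkQ_surjective _)
      (h (i + 1 + 1) (by omega) (by omega))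

/-! ### Embedding into a module of finite projective dimension -/

lemma exists_extension_to_projective {A B C P : Type u} [AddCommGroup A] [AddCommGroup B]
    [AddCommGroup C] [AddCommGroup P] [Module R A] [Module R B] [Module R C] [Module R P]
    [Module.Finite R P] [Module.Projective R P] {f : A →ₗ[R] B} {g : B →ₗ[R] C}
    (hf : Function.Injective f) (hfg : Function.Exact f g) (hg : Function.Surjective g)
    (hC : Subsingleton (Ext (ModuleCat.of R C) (ModuleCat.of R R) 1)) (φ : A →ₗ[R] P) :
    ∃ ψ : B →ₗ[R] P, ψ ∘ₗ f = φ :=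
  exists_extension_of_subsingleton_ext hf hfg hg (subsingleton_ext_of_projective hC) φ

/-- `HasFinitePdEmbedding m k X`: there is an exact sequence `0 → X → W → V → 0` of finite
modules such that `W` has projective dimension at most `k`, `V` has a dual exact coresolution of
length `m`, and `Ext^j(V, R) = 0` for `1 ≤ j ≤ k + 1`. -/
def HasFinitePdEmbedding (m k : ℕ) (X : ModuleCat.{u} R) : Prop :=
  ∃ (W V : ModuleCat.{u} R) (f : X →ₗ[R] W) (g : W →ₗ[R] V), Module.Finite R W ∧
    Function.Injective f ∧ Function.Exact f g ∧ Function.Surjective g ∧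
    HasProjectiveDimensionLT W (k + 1) ∧ HasDualExactCoresolution m V ∧
    ∀ j ≤ k, Subsingleton (Ext V (ModuleCat.of R R) (j + 1))

lemma HasDualExactCoresolution.hasFinitePdEmbedding {m : ℕ} {X : ModuleCat.{u} R}
    (h : HasDualExactCoresolution (m + 1) X) : HasFinitePdEmbedding m 0 X := by
  obtain ⟨Q, V, f, g, hQ, hQ', hf, hfg, hg, hext, hV⟩ := h
  have : Projective Q := (IsProjective.iff_projective _).1 hQ'
  refine ⟨Q, V, f, g, hQ, hf, hfg, hg, inferInstance, hV, fun j hj ↦ ?_⟩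
  obtain rfl : j = 0 := by omega
  exact subsingleton_ext_one hf hfg hg hext

/-- Since `Ext^1(V, R) = 0`, the inclusion `N → P₀` extends to `s : W → P₀`. The new middle term is
the cokernel of `W → P₀ × Q`, of projective dimension one higher; the new right end is `V' = Q/V`,
whose `Ext` vanishing comes from dual exactness in degree one and from `V` by shifting above. -/
lemma HasFinitePdEmbedding.of_syzygy {m k : ℕ} {K N : ModuleCat.{u} R}
    (h : HasFinitePdEmbedding (m + 1) k N) (P : ProjPresentation K) (e : N ≃ₗ[R] P.syzygy) :
    HasFinitePdEmbedding m (k + 1) K := by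
  obtain ⟨W, V, f, g, hW, hf, hfg, hg, hpd, ⟨Q, V', a, b, hQ, hQ', ha, hab, hb, hext, hV'⟩, hV⟩ := h
  have := P.finite_P₀; have := P.projective_P₀
  let i : N →ₗ[R] P.P₀ := (LinearMap.range P.d).subtype ∘ₗ e.toLinearMap
  have hi : Function.Injective i := Subtype.val_injective.comp e.injective
  have hiπ (p : P.P₀) : P.π p = 0 ↔ ∃ x, i x = p := by
    refine (P.exact p).trans ⟨fun ⟨y, hy⟩ ↦ ?_, ?_⟩
    · obtain ⟨x, hx⟩ := e.surjective ⟨p, y, hy⟩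
      exact ⟨x, congrArg Subtype.val hx⟩
    · rintro ⟨x, rfl⟩
      exact (e x).2
  obtain ⟨s, hs⟩ := exists_extension_to_projective hf hfg hg (hV 0 (by omega)) i
  replace hs (x) : s (f x) = i x := LinearMap.congr_fun hs x
  let c : W →ₗ[R] P.P₀ × Q := s.prod (a ∘ₗ g)
  have hc : Function.Injective c := by
    rw [injective_iff_map_eq_zero]
    intro w hw
    have h1 : s w = 0 := congrArg Prod.fst hw
    have h2 : a (g w) = 0 := congrArg Prod.snd hw
    obtain ⟨x, rfl⟩ := (hfg w).1 (ha (h2.trans (map_zero a).symm))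
    rw [hs] at h1
    rw [hi (h1.trans (map_zero i).symm), map_zero]
  have hcq := LinearMap.exact_map_mkQ_range c
  have hcs := Submodule.mkQ_surjective (LinearMap.range c)
  obtain ⟨f', hf'⟩ := exists_factor_of_surjective P.surjective
    ((LinearMap.range c).mkQ ∘ₗ LinearMap.inl R P.P₀ Q) fun p hp ↦ by
      obtain ⟨x, rfl⟩ := (hiπ p).1 hp
      refine (Submodule.Quotient.mk_eq_zero _).2 ⟨f x, ?_⟩
      simp [c, hs, hfg.apply_apply_eq_zero]
  obtain ⟨g', hg'⟩ := exists_factor_of_surjective hcs (b ∘ₗ LinearMap.snd R P.P₀ Q) fun y hy ↦ by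
    obtain ⟨w, rfl⟩ := (hcq y).1 hy
    simp [c, hab.apply_apply_eq_zero]
  have hP : Projective (ModuleCat.of R (P.P₀ × Q)) := inferInstance
  refine ⟨ModuleCat.of R ((P.P₀ × Q) ⧸ LinearMap.range c), V', f', g',
    inferInstanceAs (Module.Finite R ((P.P₀ × Q) ⧸ LinearMap.range c)), ?_, ?_, ?_, ?_, hV', ?_⟩
  · rw [injective_iff_map_eq_zero]
    intro y hy
    obtain ⟨p, rfl⟩ := P.surjective y
    rw [hf'] at hy
    obtain ⟨w, hw⟩ := (hcq _).1 hy
    have h1 : s w = p := congrArg Prod.fst hw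
    have h2 : a (g w) = 0 := congrArg Prod.snd hw
    obtain ⟨x, rfl⟩ := (hfg w).1 (ha (h2.trans (map_zero a).symm))
    exact (hiπ p).2 ⟨x, by rw [← hs, h1]⟩
  · intro y
    constructor
    · intro hy
      obtain ⟨⟨p, q⟩, rfl⟩ := hcs y
      rw [hg'] at hy
      obtain ⟨v, rfl⟩ := (hab q).1 hy
      obtain ⟨w, rfl⟩ := hg v
      refine ⟨P.π (p - s w), ?_⟩
      rw [hf']
      refine (Submodule.Quotient.eq _).2 ⟨-w, ?_⟩
      simp [c]
    · rintro ⟨x, rfl⟩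
      obtain ⟨p, rfl⟩ := P.surjective x
      rw [hf']
      exact (hg' _).trans (by simp)
  · intro v
    obtain ⟨q, rfl⟩ := hb v
    exact ⟨(LinearMap.range c).mkQ (0, q), hg' _⟩
  · exact (shortExact_of hc hcq hcs).hasProjectiveDimensionLT_X₃ (k + 1) hpd
      (hasProjectiveDimensionLT_of_ge (ModuleCat.of R (P.P₀ × Q)) 1 _ (by omega))
  · intro j hj
    cases j with
    | zero => exact subsingleton_ext_one ha hab hb hext
    | succ j =>
      obtain ⟨δ, hδ⟩ := exists_surjective_ext_succ ha hab hb (ModuleCat.of R R) (j + 1)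
      have := hV j (by omega)
      exact hδ.subsingleton

lemma HasFinitePdEmbedding.of_isSyzygy {n m k : ℕ} {M N : ModuleCat.{u} R} (hN : IsSyzygy M n N)
    (h : HasFinitePdEmbedding (n + m) k N) : HasFinitePdEmbedding m (k + n) M := by
  induction hN generalizing k with
  | zero N e =>
    obtain ⟨W, V, f, g, hW, hf, hfg, hg, hpd, hV, hE⟩ := h
    rw [zero_add] at hV
    refine ⟨W, V, f ∘ₗ e.symm.toLinearMap, g, hW, hf.comp e.symm.injective, ?_, hg, hpd, hV, hE⟩
    intro y
    exact (hfg y).trans (e.symm.surjective.exists (p := fun x ↦ f x = y))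
  | succ n K N hK P e ih =>
    rw [add_right_comm] at h
    have := ih (h.of_syzygy P e)
    rwa [add_right_comm] at this

lemma HasFinitePdEmbedding.subsingleton_ext_ext [IsNoetherianRing R] {m k : ℕ}
    {M : ModuleCat.{u} R} (h : HasFinitePdEmbedding m k M) {i j : ℕ} (hi : 1 ≤ i) (hik : i ≤ k)
    (hji : j < i) :
    Subsingleton (Ext (ModuleCat.of R (Ext M (ModuleCat.of R R) i)) (ModuleCat.of R R) j) := by
  obtain ⟨W, V, f, g, hW, hf, hfg, hg, hpd, -, hE⟩ := h
  obtain ⟨i, rfl⟩ := Nat.exists_eq_add_one_of_ne_zero (by omega : i ≠ 0)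
  let e := LinearEquiv.ofBijective (extPrecomp f (ModuleCat.of R R) (i + 1))
    ⟨extPrecomp_injective hf hfg hg (hE i (by omega)),
      extPrecomp_surjective hf hfg hg (hE (i + 1) hik)⟩
  exact subsingleton_ext_congr e.symm _ _
    (subsingleton_ext_ext_of_hasProjectiveDimensionLT W hpd hji)

end Torsionfree

end AuslanderBridger

theorem corollary2p7 {R : Type u} [CommRing R] [IsNoetherianRing R]
    (n : ℕ) (M : ModuleCat.{u} R) [Module.Finite R M]
    (N : ModuleCat.{u} R) (hN : AuslanderBridger.IsSyzygy M n N)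
    (hN' : AuslanderBridger.IsTorsionfree (n + 1) N) (i : ℕ) (hi : 1 ≤ i) (hin : i ≤ n) :
    (i : ℕ∞) ≤ AuslanderBridger.grade
      (ModuleCat.of R (Ext M (ModuleCat.of R R) i)) := by
  obtain ⟨P, hP⟩ := hN'
  -- Of the `n + 1` terms of the coresolution, one embeds `N` and the other `n` are spent climbing
  -- to `M`.
  have h := AuslanderBridger.HasFinitePdEmbedding.of_isSyzygy (m := 0) hN
    (P.hasDualExactCoresolution hP).hasFinitePdEmbedding
  refine le_iInf₂ fun j hj ↦ ?_
  by_contra! hji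
  exact not_subsingleton_iff_nontrivial.2 hj
    (h.subsingleton_ext_ext hi (by omega) (by exact_mod_cast hji))
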